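/- **Setting.** Let $M_y,M_u,D\in\mathbb N$, $M=M_y+M_u+1$, and let $\phi:\mathbb R^{M}\to\mathbb R^{D}$ be a feature map (for instance a polynomial basis expansion). Let $\hat y_i,\hat u_i\in\mathbb R$ be the observed outputs and controls; $\mathcal D_k=\{(\hat y_i,\hat u_i)\}_{i=1}^k$ is the data up to time $k$, and values at times $i\le 0$ serve as initial conditions. Put $\hat x_i=(\hat y_{i-1},\dots,\hat y_{i-M_y},\hat u_{i-1},\dots,\hat u_{i-M_u})$ and $\phi_i=\phi(\hat x_i,\hat u_i)$. Outputs have the likelihood $p(y_i\mid\theta,\tau,u_i)=\mathcal N(y_i\mid\theta^{\top}\phi(\hat x_i,u_i),\tau^{-1})$ with unknown $\theta\in\mathbb R^D$, $\tau>0$, and the prior is $p(\theta,\tau)=\mathcal N(\theta\mid\mu_0,(\tau\Lambda_0)^{-1})\,\mathcal G(\tau\mid\alpha_0,\beta_0)$ (shape $\alpha_0$, rate $\beta_0$), where $\Lambda_0$ is symmetric positive definite and $\alpha_0,\beta_0>0$. The posterior is given by Bayesian filtering: $p(\theta,\tau\mid\mathcal D_0)=p(\theta,\tau)$ and $$p(\theta,\tau\mid\mathcal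 D_i)=\frac{p(\hat y_i\mid\theta,\tau,\hat u_i)\,p(\theta,\tau\mid\mathcal D_{i-1})}{\int p(\hat y_i\mid\theta,\tau,\hat u_i)\,p(\theta,\tau\mid\mathcal D_{i-1})\,\mathrm d(\theta,\tau)} .$$ Define recursively $$\Lambda_i=\phi_i\phi_i^{\top}+\Lambda_{i-1},\quad \mu_i=\Lambda_i^{-1}(\phi_i\hat y_i+\Lambda_{i-1}\mu_{i-1}),\quad \alpha_i=\alpha_{i-1}+\tfrac12,\quad \beta_i=\beta_{i-1}+\tfrac12\big(\hat y_i^2-\mu_i^{\top}\Lambda_i\mu_i+\mu_{i-1}^{\top}\Lambda_{i-1}\mu_{i-1}\big).$$ Fix $k\ge 0$, let $t=k+1$, and for $u_t\in\mathbb R$ let $\phi_t=\phi(\hat x_t,u_t)$, $p(y_t,\theta,\tau\mid u_t)=p(y_t\mid\theta,\tau,u_t)\,p(\theta,\tau\mid\mathcal D_k)$, $p(y_t\mid u_t)=\int p(y_t,\theta,\tau\mid u_t)\,\mathrm d(\theta,\tau)$ and $p(\theta,\tau\mid y_t,u_t)=p(y_t,\theta,\tau\mid u_t)/p(y_t\mid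 u_t)$. Given a Gaussian goal prior $p(y_t\mid y_*)=\mathcal N(y_t\mid m_*,v_*)$ with $m_*\in\mathbb R$, $v_*>0$, the expected free energy function is $$\mathcal J(u_t)=\mathbb E_{p(y_t,\theta,\tau\mid u_t)}\Big[\ln\frac{p(\theta,\tau\mid\mathcal D_k)}{p(\theta,\tau\mid y_t,u_t)\,p(y_t\mid y_*)}\Big].$$ **Theorem.** Assume $\alpha_k>1$. Then there is a constant $C\in\mathbb R$, independent of $u_t$, such that for every $u_t\in\mathbb R$ all the expectations below exist (the integrands are absolutely integrable), as does the one defining $\mathcal J(u_t)$; the function $\mathcal J$ is cross-entropy minus mutual information, $$\mathcal J(u_t)=\mathbb E_{p(y_t\mid u_t)}\big[-\ln p(y_t\mid y_*)\big]-\mathbb E_{p(y_t,\theta,\tau\mid u_t)}\Big[\ln\frac{p(y_t,\theta,\tau\mid u_t)}{p(\theta,\tau\mid\mathcal D_k)\,p(y_t\mid u_t)}\Big];$$ and $$\mathcal J(u_t)=\frac1{2v_*}\Big((\mu_k^{\top}\phi_t-m_*)^2+\frac{\beta_k}{\alpha_k}\big(\phi_t^{\top}\Lambda_k^{-1}\phi_t+1\big)\frac{2\alpha_k}{2\alpha_k-2}\Big)-\frac12\ln\big(\phi_t^{\top}\Lambda_k^{-1}\phi_t+1\big)+C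 .$$ -/

import Mathlib

open MeasureTheory ProbabilityTheory Matrix

noncomputable section

namespace NARX

/-- Density at `y` of the univariate normal distribution with mean `m` and variance `v > 0`. -/
def normalPDF (m v y : ℝ) : ℝ := gaussianPDFReal m v.toNNReal y

/-- Density at `θ` (with respect to Lebesgue measure on `ℝ^D`) of the multivariate normal
distribution with mean `μ` and covariance matrix `S`. -/
def mvNormalPDF {D : ℕ} (μ : Fin D → ℝ) (S : Matrix (Fin D) (Fin D) ℝ) (θ : Fin D → ℝ) : ℝ :=
  (Real.sqrt ((2 * Real.pi) ^ D * S.det))⁻¹ *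
    Real.exp (-(1 / 2) * ((θ - μ) ⬝ᵥ (S⁻¹ *ᵥ (θ - μ))))

/-- Parameters of a multivariate normal - univariate gamma distribution on `ℝ^D × ℝ⁺`:
mean `μ`, precision matrix `Λ`, shape `α`, rate `β`. -/
structure NGParam (D : ℕ) where
  μ : Fin D → ℝ
  Λ : Matrix (Fin D) (Fin D) ℝ
  α : ℝ
  β : ℝ

/-- Normal-gamma density `N(θ | μ, (τ Λ)⁻¹) · G(τ | α, β)`; it vanishes for `τ < 0`. -/
def NGParam.pdf {D : ℕ} (q : NGParam D) (θ : Fin D → ℝ) (τ : ℝ) : ℝ :=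
  mvNormalPDF q.μ (τ • q.Λ)⁻¹ θ * gammaPDFReal q.α q.β τ

/-- The update of the normal-gamma parameters after the output `y` has been observed for the
regressor `f`. -/
def NGParam.update {D : ℕ} (q : NGParam D) (f : Fin D → ℝ) (y : ℝ) : NGParam D :=
  let Λ' : Matrix (Fin D) (Fin D) ℝ := vecMulVec f f + q.Λ
  let μ' : Fin D → ℝ := Λ'⁻¹ *ᵥ (y • f + q.Λ *ᵥ q.μ)
  { μ := μ'
    Λ := Λ'
    α := q.α + 1 / 2
    β := q.β + 1 / 2 * (y ^ 2 - μ' ⬝ᵥ (Λ' *ᵥ μ') + q.μ ⬝ᵥ (q.Λ *ᵥ q.μ)) }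

/-- A NARX agent: the basis expansion `φ` of `M_y` past outputs, `M_u` past controls and the current
control, the parameters of the normal-gamma prior, and the observed outputs and controls.
The data are those at times `1, 2, …`; values at times `≤ 0` only serve as initial conditions
in the delay vectors. -/
structure Agent (My Mu D : ℕ) where
  φ : (Fin (My + Mu + 1) → ℝ) → (Fin D → ℝ)
  prior : NGParam D
  yObs : ℤ → ℝ
  uObs : ℤ → ℝ

namespace Agent

variable {My Mu D : ℕ} (A : Agent My Mu D)

/-- The delay vector `x_t = (y_{t-1}, …, y_{t-M_y}, u_{t-1}, …, u_{t-M_u})` of observed values. -/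
def delay (t : ℤ) : Fin (My + Mu) → ℝ :=
  Fin.append (fun i : Fin My => A.yObs (t - 1 - (i : ℕ)))
    (fun j : Fin Mu => A.uObs (t - 1 - (j : ℕ)))

/-- The regressor `φ(x_t, u)`. -/
def feature (t : ℤ) (u : ℝ) : Fin D → ℝ :=
  A.φ (Fin.snoc (α := fun _ => ℝ) (A.delay t) u)

/-- The likelihood `p(y | θ, τ, u) = N(y | θᵀ φ(x_t, u), τ⁻¹)` at time `t`. -/
def likelihood (t : ℤ) (u y : ℝ) (θ : Fin D → ℝ) (τ : ℝ) : ℝ :=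
  normalPDF (θ ⬝ᵥ A.feature t u) τ⁻¹ y

/-- The parameter posterior `p(θ, τ | D_k)`, by Bayesian filtering from the normal-gamma prior:
likelihood times previous posterior, divided by the evidence. -/
def posterior : ℕ → (Fin D → ℝ) → ℝ → ℝ
  | 0 => A.prior.pdf
  | k + 1 => fun θ τ =>
      A.likelihood (k + 1) (A.uObs (k + 1)) (A.yObs (k + 1)) θ τ * posterior k θ τ /
        ∫ w : (Fin D → ℝ) × ℝ,
          A.likelihood (k + 1) (A.uObs (k + 1)) (A.yObs (k + 1)) w.1 w.2 * posterior k w.1 w.2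

/-- The parameters `(μ_k, Λ_k, α_k, β_k)` given by the recursive update rules. -/
def param : ℕ → NGParam D
  | 0 => A.prior
  | k + 1 => (param k).update (A.feature (k + 1) (A.uObs (k + 1))) (A.yObs (k + 1))

/-! In what follows `t = k + 1` is the next time step and `u` is the control `u_t`. -/

/-- The joint density `p(y_t, θ, τ | u_t) = p(y_t | θ, τ, u_t) p(θ, τ | D_k)`. -/
def joint (k : ℕ) (u y : ℝ) (θ : Fin D → ℝ) (τ : ℝ) : ℝ :=
  A.likelihood (k + 1) u y θ τ * A.posterior k θ τ

/-- The posterior predictive density `p(y_t | u_t)`. -/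
def predictive (k : ℕ) (u y : ℝ) : ℝ :=
  ∫ w : (Fin D → ℝ) × ℝ, A.joint k u y w.1 w.2

/-- The parameter density `p(θ, τ | y_t, u_t)` given a future output, by Bayes' rule. -/
def futurePosterior (k : ℕ) (u y : ℝ) (θ : Fin D → ℝ) (τ : ℝ) : ℝ :=
  A.joint k u y θ τ / A.predictive k u y

/-- Integrand of `E_{p(y_t, θ, τ | u_t)} [ln (p(θ, τ | D_k) / (p(θ, τ | y_t, u_t) p(y_t | y_*)))]`,
with goal prior `p(y_t | y_*) = N(y_t | m, v)`. -/
def efeIntegrand (k : ℕ) (m v u : ℝ) (z : ℝ × (Fin D → ℝ) × ℝ) : ℝ :=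
  A.joint k u z.1 z.2.1 z.2.2 *
    Real.log (A.posterior k z.2.1 z.2.2 /
      (A.futurePosterior k u z.1 z.2.1 z.2.2 * normalPDF m v z.1))

/-- The expected free energy function `J(u_t)`. -/
def efe (k : ℕ) (m v u : ℝ) : ℝ :=
  ∫ z : ℝ × (Fin D → ℝ) × ℝ, A.efeIntegrand k m v u z

/-- Integrand of `E_{p(y_t | u_t)} [-ln p(y_t | y_*)]`. -/
def crossEntropyIntegrand (k : ℕ) (m v u y : ℝ) : ℝ :=
  A.predictive k u y * -Real.log (normalPDF m v y)

/-- The cross-entropy of the goal prior relative to the posterior predictive distribution. -/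
def crossEntropy (k : ℕ) (m v u : ℝ) : ℝ :=
  ∫ y : ℝ, A.crossEntropyIntegrand k m v u y

/-- Integrand of
`E_{p(y_t, θ, τ | u_t)} [ln (p(y_t, θ, τ | u_t) / (p(θ, τ | D_k) p(y_t | u_t)))]`. -/
def mutualInfoIntegrand (k : ℕ) (u : ℝ) (z : ℝ × (Fin D → ℝ) × ℝ) : ℝ :=
  A.joint k u z.1 z.2.1 z.2.2 *
    Real.log (A.joint k u z.1 z.2.1 z.2.2 /
      (A.posterior k z.2.1 z.2.2 * A.predictive k u z.1))

/-- The mutual information between the parameters `(θ, τ)` and the predicted output `y_t`. -/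
def mutualInfo (k : ℕ) (u : ℝ) : ℝ :=
  ∫ z : ℝ × (Fin D → ℝ) × ℝ, A.mutualInfoIntegrand k u z

end Agent

end NARX

end

/-! Bayes' rule turns the log-ratio in `efe` into minus the log goal density minus the log-ratio of
the mutual information, pointwise for `τ > 0`. This gives cross-entropy minus mutual information
once both parts are integrable (`integral_efe`).

Everything explicit rests on conjugacy (`normalPDF_mul_pdf`): likelihood times normal-gamma density
is `evidence` times the updated normal-gamma density. Hence the filtered posterior is the closed
form (`posterior_eq`), and the predictive law is that of `s x + μᵀφ`, where `s² = φᵀΛ⁻¹φ + 1` and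
`x` has a Student density independent of the control.

The cross-entropy is quadratic in the output, so it needs only two Student moments; `α > 1` makes
the second one finite. In the mutual information, joint over posterior is the likelihood, so it
equals the mean log-likelihood minus the mean log-predictive. Given `(θ, τ)` the first is a Gaussian
entropy depending on `τ` alone, hence constant in `u`. The second depends on `u` only through the
Jacobian, which contributes `-½ ln s²`.

Formulas are compared off the null set `τ = 0`, where default values intervene. -/

noncomputable section

namespace NARX

/-! ### Rank-one updates of a precision matrix and completing the square. -/

section LinearAlgebra

variable {D : ℕ} {L : Matrix (Fin D) (Fin D) ℝ}

theorem posDef_vecMulVec_add (hL : L.PosDef) (f : Fin D → ℝ) : (vecMulVec f f + L).PosDef := by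
  have h := posSemidef_vecMulVec_self_star f
  rw [star_trivial] at h
  exact Matrix.PosDef.posSemidef_add h hL

theorem PosDef.dotProduct_mulVec_comm (hL : L.PosDef) (x y : Fin D → ℝ) :
    x ⬝ᵥ (L *ᵥ y) = y ⬝ᵥ (L *ᵥ x) := by
  have hT : Lᵀ = L := by simpa using hL.isHermitian.eq
  rw [dotProduct_mulVec, ← mulVec_transpose, hT, dotProduct_comm]

theorem PosDef.mulVec_inv_mulVec (hL : L.PosDef) (x : Fin D → ℝ) : L *ᵥ (L⁻¹ *ᵥ x) = x := by
  rw [mulVec_mulVec, mul_nonsing_inv _ hL.det_pos.ne'.isUnit, one_mulVec]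

theorem PosDef.inv_mulVec_mulVec (hL : L.PosDef) (x : Fin D → ℝ) : L⁻¹ *ᵥ (L *ᵥ x) = x := by
  rw [mulVec_mulVec, nonsing_inv_mul _ hL.det_pos.ne'.isUnit, one_mulVec]

theorem one_add_quadForm_inv_pos (hL : L.PosDef) (f : Fin D → ℝ) : 0 < f ⬝ᵥ (L⁻¹ *ᵥ f) + 1 := by
  have := hL.inv.posSemidef.dotProduct_mulVec_nonneg f
  rw [star_trivial] at this
  linarith

/-- Matrix determinant lemma. The ratio of the two determinants becomes the squared scale of the
predictive density. -/
theorem det_vecMulVec_add (hL : L.PosDef) (f : Fin D → ℝ) :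
    (vecMulVec f f + L).det = L.det * (f ⬝ᵥ (L⁻¹ *ᵥ f) + 1) := by
  rw [add_comm, vecMulVec_eq Unit, det_add_replicateCol_mul_replicateRow hL.det_pos.ne'.isUnit,
    add_comm (1 : Matrix Unit Unit ℝ)]
  congr 1
  simp [Matrix.det_unique, Matrix.mul_assoc, replicateRow, replicateCol, Matrix.mul_apply,
    dotProduct, mulVec, Finset.mul_sum]

theorem vecMulVec_mulVec' (f x : Fin D → ℝ) : vecMulVec f f *ᵥ x = (f ⬝ᵥ x) • f := by
  ext i
  simp [vecMulVec_apply, mulVec, dotProduct, Finset.sum_mul]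
  exact Finset.sum_congr rfl fun _ _ => by ring

/-- The posterior mean as a correction of the prior mean by the prediction error. -/
theorem update_mean_eq (hL : L.PosDef) (μ f : Fin D → ℝ) (y : ℝ) :
    (vecMulVec f f + L)⁻¹ *ᵥ (y • f + L *ᵥ μ) =
      μ + ((y - μ ⬝ᵥ f) / (f ⬝ᵥ (L⁻¹ *ᵥ f) + 1)) • (L⁻¹ *ᵥ f) := by
  have hs := one_add_quadForm_inv_pos hL f
  set s := f ⬝ᵥ (L⁻¹ *ᵥ f)
  -- Applying the updated precision to the candidate avoids expanding its inverse by
  -- Sherman–Morrison.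
  have key : y • f + L *ᵥ μ = (vecMulVec f f + L) *ᵥ
      (μ + ((y - μ ⬝ᵥ f) / (s + 1)) • (L⁻¹ *ᵥ f)) := by
    rw [add_mulVec, vecMulVec_mulVec', mulVec_add L, mulVec_smul, PosDef.mulVec_inv_mulVec hL,
      dotProduct_add, dotProduct_smul, dotProduct_comm f μ]
    have : y = μ ⬝ᵥ f + (y - μ ⬝ᵥ f) / (s + 1) * s + (y - μ ⬝ᵥ f) / (s + 1) := by
      field_simp; ring
    ext i
    simp only [Pi.add_apply, Pi.smul_apply, smul_eq_mul]
    change y * f i + _ = (_ + _ * s) * f i + _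
    linear_combination f i * this
  rw [key, PosDef.inv_mulVec_mulVec (posDef_vecMulVec_add hL f)]

/-- Completing the square in the exponent of likelihood times prior. -/
theorem sq_add_quadForm_eq (hL : L.PosDef) (μ f θ : Fin D → ℝ) (y : ℝ) :
    let L' := vecMulVec f f + L
    let μ' := L'⁻¹ *ᵥ (y • f + L *ᵥ μ)
    (y - θ ⬝ᵥ f) ^ 2 + (θ - μ) ⬝ᵥ (L *ᵥ (θ - μ)) =
      (y - μ ⬝ᵥ f) ^ 2 / (f ⬝ᵥ (L⁻¹ *ᵥ f) + 1) + (θ - μ') ⬝ᵥ (L' *ᵥ (θ - μ')) := by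
  intro L' μ'
  have hs := one_add_quadForm_inv_pos hL f
  set s := f ⬝ᵥ (L⁻¹ *ᵥ f) with hsdef
  set c := (y - μ ⬝ᵥ f) / (s + 1) with hc
  have hμ : μ' = μ + c • (L⁻¹ *ᵥ f) := update_mean_eq hL μ f y
  have hcs : y - μ ⬝ᵥ f = c * (s + 1) := by rw [hc]; field_simp
  obtain ⟨d, rfl⟩ : ∃ d, θ = μ + d := ⟨θ - μ, by abel⟩
  have h1 : μ + d - μ' = d - c • (L⁻¹ *ᵥ f) := by rw [hμ]; abel
  rw [h1, add_sub_cancel_left, add_mulVec, vecMulVec_mulVec', mulVec_sub L, mulVec_smul,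
    PosDef.mulVec_inv_mulVec hL]
  have h2 : (L⁻¹ *ᵥ f) ⬝ᵥ (L *ᵥ d) = d ⬝ᵥ f := by
    rw [PosDef.dotProduct_mulVec_comm hL, PosDef.mulVec_inv_mulVec hL]
  have h3 : (L⁻¹ *ᵥ f) ⬝ᵥ f = s := dotProduct_comm _ _
  simp only [sub_dotProduct, dotProduct_sub, dotProduct_add, add_dotProduct, smul_dotProduct,
    dotProduct_smul, smul_eq_mul, h2, h3, ← hsdef, dotProduct_comm f d]
  have h4 : (y - μ ⬝ᵥ f) ^ 2 / (s + 1) = c ^ 2 * (s + 1) := by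
    rw [hcs]; field_simp
  rw [h4, show y = μ ⬝ᵥ f + c * (s + 1) by linarith]
  ring

/-- This is the completed square at `θ = 0`. In this form the rate visibly stays positive, and the
increment is half a squared standardized prediction error. -/
theorem update_rate_eq (q : NGParam D) (hL : q.Λ.PosDef) (f : Fin D → ℝ) (y : ℝ) :
    (q.update f y).β = q.β + ((y - q.μ ⬝ᵥ f) ^ 2 / (f ⬝ᵥ (q.Λ⁻¹ *ᵥ f) + 1)) / 2 := by
  have h := sq_add_quadForm_eq hL q.μ f 0 y
  simp only [zero_dotProduct, zero_sub, mulVec_neg, dotProduct_neg, neg_dotProduct, neg_neg,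
    sub_zero] at h
  simp only [NGParam.update]
  linarith

end LinearAlgebra

/-! ### Multivariate Gaussian integrals. -/

section Gaussian

variable {D : ℕ}

theorem integral_exp_neg_half_sq : ∫ x : ℝ, Real.exp (-(1 / 2) * x ^ 2) = √(2 * Real.pi) := by
  rw [integral_gaussian]; congr 1; ring

theorem exp_neg_half_dotProduct_self :
    (fun x : Fin D → ℝ => Real.exp (-(1 / 2) * (x ⬝ᵥ x))) =
      fun x => ∏ i, Real.exp (-(1 / 2) * x i ^ 2) := by
  ext x
  rw [← Real.exp_sum, dotProduct, Finset.mul_sum]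
  simp [pow_two]

theorem integrable_exp_neg_half_dotProduct_self :
    Integrable fun x : Fin D → ℝ => Real.exp (-(1 / 2) * (x ⬝ᵥ x)) := by
  rw [exp_neg_half_dotProduct_self]
  exact Integrable.fintype_prod fun _ => integrable_exp_neg_mul_sq (by norm_num)

theorem integral_exp_neg_half_dotProduct_self :
    ∫ x : Fin D → ℝ, Real.exp (-(1 / 2) * (x ⬝ᵥ x)) = √(2 * Real.pi) ^ D := by
  rw [exp_neg_half_dotProduct_self,
    integral_fintype_prod_volume_eq_pow (fun x : ℝ => Real.exp (-(1 / 2) * x ^ 2)),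
    integral_exp_neg_half_sq, Fintype.card_fin]

open scoped MatrixOrder in
theorem exists_transpose_mul_self {S : Matrix (Fin D) (Fin D) ℝ} (hS : S.PosDef) :
    ∃ B : Matrix (Fin D) (Fin D) ℝ, S = Bᵀ * B ∧ B.det ≠ 0 ∧ S.det = B.det ^ 2 := by
  obtain ⟨B, hB⟩ := (CStarAlgebra.nonneg_iff_eq_star_mul_self (a := S)).mp hS.posSemidef.nonneg
  have hB' : S = Bᵀ * B := by simpa [star_eq_conjTranspose] using hB
  have hd : S.det = B.det ^ 2 := by rw [hB', det_mul, det_transpose, sq]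
  refine ⟨B, hB', fun h => ?_, hd⟩
  have := hS.det_pos
  rw [hd, h] at this
  simp at this

/-- Writing `S = BᵀB`, the substitution by `B` reduces to a product of standard Gaussians, with
Jacobian factor `|det B|⁻¹ = (det S)^(-1/2)`. -/
theorem quadForm_gaussian {S : Matrix (Fin D) (Fin D) ℝ} (hS : S.PosDef) (μ : Fin D → ℝ) :
    Integrable (fun x => Real.exp (-(1 / 2) * ((x - μ) ⬝ᵥ (S *ᵥ (x - μ))))) ∧
    ∫ x, Real.exp (-(1 / 2) * ((x - μ) ⬝ᵥ (S *ᵥ (x - μ)))) =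
      √((2 * Real.pi) ^ D * S.det⁻¹) := by
  obtain ⟨B, hB, hdet, hSdet⟩ := exists_transpose_mul_self hS
  let F : (Fin D → ℝ) → ℝ := fun x => Real.exp (-(1 / 2) * (x ⬝ᵥ x))
  have hF : (fun x : Fin D → ℝ => Real.exp (-(1 / 2) * (x ⬝ᵥ (S *ᵥ x)))) =
      fun x => F (toLin' B x) := by
    ext x
    simp only [F, toLin'_apply, hB]
    rw [← mulVec_mulVec, dotProduct_mulVec, vecMul_transpose]
  let e := (LinearEquiv.ofIsUnitDet (f := toLin' B) (v := Pi.basisFun ℝ (Fin D))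
    (v' := Pi.basisFun ℝ (Fin D)) (by simpa [LinearMap.toMatrix_eq_toMatrix'] using hdet)
    ).toContinuousLinearEquiv.toHomeomorph.toMeasurableEquiv
  have hmap := Real.map_matrix_volume_pi_eq_smul_volume_pi hdet
  have hmap' : Measure.map e volume = ENNReal.ofReal |B.det⁻¹| • volume := hmap
  have hint : Integrable fun x => F (toLin' B x) := by
    have := (integrable_map_equiv (μ := volume) e F).mp (by
      rw [hmap']
      exact integrable_exp_neg_half_dotProduct_self.smul_measure ENNReal.ofReal_ne_top)
    exact this
  have hval : ∫ x, F (toLin' B x) = √((2 * Real.pi) ^ D * S.det⁻¹) := by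
    have := integral_map_equiv (μ := volume) e F
    rw [hmap', integral_smul_measure, integral_exp_neg_half_dotProduct_self] at this
    rw [show (fun x => F (toLin' B x)) = fun x => F (e x) from rfl, ← this, hSdet,
      Real.sqrt_mul (by positivity) (B.det ^ 2)⁻¹, ENNReal.toReal_ofReal (abs_nonneg _), ← inv_pow,
      Real.sqrt_sq_eq_abs, smul_eq_mul, mul_comm]
    congr 1
    refine ((Real.sqrt_eq_iff_eq_sq (by positivity) (by positivity)).mpr ?_).symm
    rw [← pow_mul, mul_comm D, pow_mul, Real.sq_sqrt (by positivity)]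
  constructor
  · exact (hF ▸ hint).comp_sub_right μ
  · rw [← hval, ← hF]
    exact integral_sub_right_eq_self
      (fun x : Fin D → ℝ => Real.exp (-(1 / 2) * (x ⬝ᵥ (S *ᵥ x)))) μ

end Gaussian

/-! ### Fubini for integrands with factorized sections. -/

section Fubini

variable {X Y : Type*} [MeasurableSpace X] [MeasurableSpace Y] {μ : Measure X} {ν : Measure Y}
  [SFinite μ] [SFinite ν]

/-- Fubini for functions whose sections are multiples of nonnegative integrable functions. -/
theorem integrable_and_integral_of_sections {F : X × Y → ℝ} {g : X → ℝ}
    (hF : AEStronglyMeasurable F (μ.prod ν)) (hg : Integrable g μ)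
    (h : ∀ᵐ x ∂μ, ∃ (c : ℝ) (K : Y → ℝ), (∀ᵐ y ∂ν, F (x, y) = c * K y) ∧ (∀ y, 0 ≤ K y) ∧
      Integrable K ν ∧ c * ∫ y, K y ∂ν = g x) :
    Integrable F (μ.prod ν) ∧ ∫ z, F z ∂(μ.prod ν) = ∫ x, g x ∂μ := by
  have hint : Integrable F (μ.prod ν) := by
    rw [integrable_prod_iff hF]
    constructor
    · filter_upwards [h] with x ⟨c, K, hc, _, hK, _⟩
      exact (hK.const_mul c).congr (by filter_upwards [hc] with y hy using hy.symm)
    -- Because `K ≥ 0`, the section has L¹ norm `|c| ∫ K = |g x|`, so integrability of `g` suffices.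
    · refine hg.norm.congr ?_
      filter_upwards [h] with x ⟨c, K, hc, hK0, hK, hgx⟩
      rw [← hgx, norm_mul, Real.norm_of_nonneg (integral_nonneg hK0), ← integral_const_mul]
      refine integral_congr_ae ?_
      filter_upwards [hc] with y hy
      rw [hy, norm_mul, Real.norm_of_nonneg (hK0 y)]
  refine ⟨hint, ?_⟩
  rw [integral_prod F hint]
  refine integral_congr_ae ?_
  filter_upwards [h] with x ⟨c, K, hc, _, _, hgx⟩
  rw [← hgx, ← integral_const_mul]
  exact integral_congr_ae hc

theorem integrable_and_integral_of_sections_symm {F : X × Y → ℝ} {g : Y → ℝ}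
    (hF : AEStronglyMeasurable F (μ.prod ν)) (hg : Integrable g ν)
    (h : ∀ᵐ y ∂ν, ∃ (c : ℝ) (K : X → ℝ), (∀ᵐ x ∂μ, F (x, y) = c * K x) ∧ (∀ x, 0 ≤ K x) ∧
      Integrable K μ ∧ c * ∫ x, K x ∂μ = g y) :
    Integrable F (μ.prod ν) ∧ ∫ z, F z ∂(μ.prod ν) = ∫ y, g y ∂ν := by
  have := integrable_and_integral_of_sections (F := F ∘ Prod.swap) hF.prod_swap hg h
  exact ⟨integrable_swap_iff.mp this.1, by rw [← this.2, ← integral_prod_swap]; rfl⟩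

end Fubini

/-! ### Univariate normal density: logarithm and variance. -/

section Normal

theorem normalPDF_eq {v : ℝ} (hv : 0 < v) (m y : ℝ) :
    normalPDF m v y = (√(2 * Real.pi * v))⁻¹ * Real.exp (-(y - m) ^ 2 / (2 * v)) := by
  simp [normalPDF, gaussianPDFReal, hv.le]

theorem normalPDF_pos {v : ℝ} (hv : 0 < v) (m y : ℝ) : 0 < normalPDF m v y :=
  gaussianPDFReal_pos _ _ _ (by simpa using hv)

theorem normalPDF_nonneg (m v y : ℝ) : 0 ≤ normalPDF m v y := gaussianPDFReal_nonneg _ _ _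

theorem normalPDF_of_nonpos {v : ℝ} (hv : v ≤ 0) (m y : ℝ) : normalPDF m v y = 0 := by
  simp [normalPDF, Real.toNNReal_of_nonpos hv]

theorem integrable_normalPDF (m v : ℝ) : Integrable (normalPDF m v) :=
  integrable_gaussianPDFReal _ _

theorem integral_normalPDF {v : ℝ} (hv : 0 < v) (m : ℝ) : ∫ y, normalPDF m v y = 1 :=
  integral_gaussianPDFReal_eq_one _ (by simpa using hv)

theorem log_normalPDF {v : ℝ} (hv : 0 < v) (m y : ℝ) :
    Real.log (normalPDF m v y) = -(1 / 2) * Real.log (2 * Real.pi * v) - (y - m) ^ 2 / (2 * v) := by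
  rw [normalPDF_eq hv, Real.log_mul (by positivity) (by positivity), Real.log_inv,
    Real.log_sqrt (by positivity), Real.log_exp]
  ring

theorem measurable_normalPDF_comp {X : Type*} [MeasurableSpace X] {a b c : X → ℝ}
    (ha : Measurable a) (hb : Measurable b) (hc : Measurable c) :
    Measurable fun x => normalPDF (a x) (b x) (c x) :=
  measurable_uncurry_gaussianPDFReal.comp (ha.prodMk (hb.real_toNNReal.prodMk hc))

theorem normalPDF_sq {v : ℝ} (hv : 0 < v) (m : ℝ) :
    Integrable (fun y => normalPDF m v y * (y - m) ^ 2) ∧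
      ∫ y, normalPDF m v y * (y - m) ^ 2 = v := by
  have hv' : v.toNNReal ≠ 0 := by simpa using hv
  have hval : ∫ y, normalPDF m v y * (y - m) ^ 2 = v := by
    have h := variance_fun_id_gaussianReal (μ := m) (v := v.toNNReal)
    rw [variance_eq_integral measurable_id'.aemeasurable, integral_id_gaussianReal,
      integral_gaussianReal_eq_integral_smul hv', Real.coe_toNNReal _ hv.le] at h
    exact h
  -- A non-integrable function has integral 0 by convention, so a nonzero value proves
  -- integrability.
  exact ⟨Integrable.of_integral_ne_zero (by rw [hval]; exact hv.ne'), hval⟩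

end Normal

/-! ### Gamma density: inverse and logarithmic moments. -/

section Gamma

variable {a r : ℝ}

theorem gammaPDFReal_of_neg {t : ℝ} (ht : t < 0) : gammaPDFReal a r t = 0 := by
  simp [gammaPDFReal, ht.not_ge]

theorem gammaPDFReal_of_pos {t : ℝ} (ht : 0 < t) :
    gammaPDFReal a r t = r ^ a / Real.Gamma a * t ^ (a - 1) * Real.exp (-(r * t)) := by
  simp [gammaPDFReal, ht.le]

theorem gammaPDFReal_integral (ha : 0 < a) (hr : 0 < r) :
    Integrable (gammaPDFReal a r) ∧ ∫ t, gammaPDFReal a r t = 1 := by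
  have hval : ∫ t, gammaPDFReal a r t = 1 := by
    rw [integral_eq_lintegral_of_nonneg_ae
      (Filter.Eventually.of_forall (gammaPDFReal_nonneg ha hr))
      (measurable_gammaPDFReal a r).aestronglyMeasurable]
    have := lintegral_gammaPDF_eq_one ha hr
    simp only [gammaPDF] at this
    simp [this]
  exact ⟨Integrable.of_integral_ne_zero (by rw [hval]; exact one_ne_zero), hval⟩

/-- Lowering the shape by one costs `Γ(a) = (a - 1) Γ(a - 1)`. At `t = 0` the convention `0⁻¹ = 0`
breaks the identity when `a = 2`. -/
theorem gammaPDFReal_mul_inv (ha : 1 < a) (hr : 0 < r) {t : ℝ} (ht : t ≠ 0) :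
    gammaPDFReal a r t * t⁻¹ = r / (a - 1) * gammaPDFReal (a - 1) r t := by
  rcases ht.lt_or_gt with ht | ht
  · simp [gammaPDFReal_of_neg ht]
  · rw [gammaPDFReal_of_pos ht, gammaPDFReal_of_pos ht]
    have h1 : Real.Gamma a = (a - 1) * Real.Gamma (a - 1) := by
      have := Real.Gamma_add_one (s := a - 1) (by linarith)
      rwa [sub_add_cancel] at this
    have h2 : r ^ a = r ^ (a - 1) * r := by
      rw [← Real.rpow_add_one hr.ne', sub_add_cancel]
    have h3 : t ^ (a - 1) = t ^ (a - 1 - 1) * t := by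
      rw [← Real.rpow_add_one ht.ne', sub_add_cancel]
    have h4 : 0 < Real.Gamma (a - 1) := Real.Gamma_pos_of_pos (by linarith)
    have h5 : a - 1 ≠ 0 := by linarith
    rw [h1, h2, h3]
    field_simp

theorem gammaPDFReal_inv_integral (ha : 1 < a) (hr : 0 < r) :
    Integrable (fun t => gammaPDFReal a r t * t⁻¹) ∧
      ∫ t, gammaPDFReal a r t * t⁻¹ = r / (a - 1) := by
  have hae : (fun t => r / (a - 1) * gammaPDFReal (a - 1) r t) =ᵐ[volume]
      fun t => gammaPDFReal a r t * t⁻¹ := by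
    filter_upwards [Measure.ae_ne volume (0 : ℝ)] with t ht using (gammaPDFReal_mul_inv ha hr ht).symm
  have h := gammaPDFReal_integral (a := a - 1) (by linarith) hr
  exact ⟨(h.1.const_mul _).congr hae, by
    rw [← integral_congr_ae hae, integral_const_mul, h.2, mul_one]⟩

theorem gammaPDFReal_mul_self (ha : 0 < a) (hr : 0 < r) {t : ℝ} (ht : t ≠ 0) :
    gammaPDFReal a r t * t = a / r * gammaPDFReal (a + 1) r t := by
  have h := gammaPDFReal_mul_inv (a := a + 1) (by linarith) hr ht
  rw [add_sub_cancel_right] at h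
  have : gammaPDFReal a r t = a / r * (gammaPDFReal (a + 1) r t * t⁻¹) := by
    rw [h]; field_simp
  rw [this]; field_simp

/-- Domination by `|log t| ≤ t + t⁻¹`, both terms having finite gamma mean. -/
theorem integrable_gammaPDFReal_mul_log (ha : 1 < a) (hr : 0 < r) :
    Integrable fun t => gammaPDFReal a r t * Real.log t := by
  have h1 : Integrable fun t => gammaPDFReal a r t * t := by
    refine (((gammaPDFReal_integral (a := a + 1) (by linarith) hr).1).const_mul (a / r)).congr ?_
    filter_upwards [Measure.ae_ne volume (0 : ℝ)] with t ht
      using (gammaPDFReal_mul_self (by linarith) hr ht).symm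
  refine (h1.add (gammaPDFReal_inv_integral ha hr).1).mono'
    ((measurable_gammaPDFReal a r).mul Real.measurable_log).aestronglyMeasurable ?_
  filter_upwards [Measure.ae_ne volume (0 : ℝ)] with t ht
  rcases ht.lt_or_gt with ht | ht
  · simp [gammaPDFReal_of_neg ht]
  · have h0 := gammaPDFReal_nonneg (by linarith : 0 < a) hr t
    simp only [Pi.add_apply]
    rw [norm_mul, Real.norm_of_nonneg h0, ← mul_add]
    refine mul_le_mul_of_nonneg_left ?_ h0
    have h2 := Real.log_le_sub_one_of_pos ht
    have h3 := Real.log_le_sub_one_of_pos (inv_pos.mpr ht)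
    rw [Real.log_inv] at h3
    have := inv_pos.mpr ht
    exact abs_le.mpr ⟨by linarith, by linarith⟩

end Gamma

/-! ### Student density as a gamma scale mixture of normals. -/

section Student

/-- The density of `√τ⁻¹ ε` for a standard normal `ε` and an independent gamma variable `τ` with
shape `a` and rate `r`: a scaled Student distribution with `2a` degrees of freedom. -/
def studentPDF (a r x : ℝ) : ℝ :=
  r ^ a * Real.Gamma (a + 1 / 2) / (√(2 * Real.pi) * Real.Gamma a) *
    (r + x ^ 2 / 2) ^ (-(a + 1 / 2))

variable {a r : ℝ}

theorem studentPDF_pos (ha : 0 < a) (hr : 0 < r) (x : ℝ) : 0 < studentPDF a r x := by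
  have h1 := Real.Gamma_pos_of_pos ha
  have h2 : 0 < Real.Gamma (a + 1 / 2) := Real.Gamma_pos_of_pos (by linarith)
  unfold studentPDF
  positivity

theorem measurable_studentPDF (a r : ℝ) : Measurable (studentPDF a r) := by
  unfold studentPDF
  fun_prop

/-- Scalar conjugacy: as a function of `t` the product is an unnormalized gamma density, and the
Student density is its mass. -/
theorem normalPDF_mul_gammaPDFReal (ha : 0 < a) (hr : 0 < r) (x : ℝ) {t : ℝ} (ht : t ≠ 0) :
    normalPDF 0 t⁻¹ x * gammaPDFReal a r t =
      studentPDF a r x * gammaPDFReal (a + 1 / 2) (r + x ^ 2 / 2) t := by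
  rcases ht.lt_or_gt with ht | ht
  · simp [gammaPDFReal_of_neg ht]
  · rw [normalPDF_eq (inv_pos.mpr ht), gammaPDFReal_of_pos ht, gammaPDFReal_of_pos ht, studentPDF]
    have h1 := Real.Gamma_pos_of_pos ha
    have h2 : 0 < Real.Gamma (a + 1 / 2) := Real.Gamma_pos_of_pos (by linarith)
    have hR : 0 < r + x ^ 2 / 2 := by positivity
    have h3 : t ^ (a + 1 / 2 - 1) = t ^ (a - 1) * √t := by
      rw [Real.sqrt_eq_rpow, ← Real.rpow_add ht]; congr 1; ring
    have h4 : Real.exp (-((r + x ^ 2 / 2) * t)) =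
        Real.exp (-(x - 0) ^ 2 / (2 * t⁻¹)) * Real.exp (-(r * t)) := by
      rw [← Real.exp_add]; congr 1; field_simp; ring
    have h5 : (√(2 * Real.pi * t⁻¹))⁻¹ = (√(2 * Real.pi))⁻¹ * √t := by
      rw [Real.sqrt_mul (by positivity), Real.sqrt_inv, mul_inv, inv_inv]
    rw [h3, h4, h5, Real.rpow_neg hR.le]
    have : (0 : ℝ) < (r + x ^ 2 / 2) ^ (a + 1 / 2) := by positivity
    field_simp

/-- Moments of the Student density, from its representation as a scale mixture. -/
theorem studentPDF_mixture (ha : 0 < a) (hr : 0 < r) {h e : ℝ → ℝ} (hm : Measurable h)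
    (h0 : ∀ x, 0 ≤ h x) (he : Integrable fun t => gammaPDFReal a r t * e t)
    (hint : ∀ t, 0 < t → Integrable (fun x => normalPDF 0 t⁻¹ x * h x))
    (hval : ∀ t, 0 < t → ∫ x, normalPDF 0 t⁻¹ x * h x = e t) :
    Integrable (fun x => studentPDF a r x * h x) ∧
      ∫ x, studentPDF a r x * h x = ∫ t, gammaPDFReal a r t * e t := by
  let F : ℝ × ℝ → ℝ := fun z => gammaPDFReal a r z.1 * (normalPDF 0 z.1⁻¹ z.2 * h z.2)
  have hF : Measurable F := ((measurable_gammaPDFReal a r).comp measurable_fst).mul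
    ((measurable_normalPDF_comp measurable_const measurable_fst.inv measurable_snd).mul
      (hm.comp measurable_snd))
  obtain ⟨h1, h2⟩ := integrable_and_integral_of_sections (F := F) (μ := volume) (ν := volume)
    hF.aestronglyMeasurable he (by
      filter_upwards [Measure.ae_ne volume (0 : ℝ)] with t ht
      rcases ht.lt_or_gt with ht | ht
      · exact ⟨0, 0, by simp [F, gammaPDFReal_of_neg ht], by simp, by simp [Pi.zero_def],
          by simp [gammaPDFReal_of_neg ht]⟩
      · exact ⟨gammaPDFReal a r t, _, Filter.Eventually.of_forall fun _ => rfl,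
          fun x => mul_nonneg (normalPDF_nonneg _ _ _) (h0 x), hint t ht, by rw [hval t ht]⟩)
  -- Integrating over `x` first gave the mixture of the `e t`; integrating over `t` first leaves the
  -- Student density.
  have h3 : ∀ x, ∫ t, F (t, x) = studentPDF a r x * h x := by
    intro x
    have hg := gammaPDFReal_integral (a := a + 1 / 2) (r := r + x ^ 2 / 2) (by linarith)
      (by positivity)
    rw [← mul_one (studentPDF a r x * h x), ← hg.2, ← integral_const_mul]
    refine integral_congr_ae ?_
    filter_upwards [Measure.ae_ne volume (0 : ℝ)] with t ht
    have := normalPDF_mul_gammaPDFReal ha hr x ht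
    simp only [F]
    linear_combination h x * this
  have h4 := h1.integral_prod_right
  rw [integral_prod_symm F h1] at h2
  simp only [h3] at h4 h2
  exact ⟨h4, h2⟩

theorem studentPDF_integral (ha : 0 < a) (hr : 0 < r) :
    Integrable (studentPDF a r) ∧ ∫ x, studentPDF a r x = 1 := by
  have hg := gammaPDFReal_integral ha hr
  have := studentPDF_mixture ha hr (h := fun _ => 1) (e := fun _ => 1) measurable_const
    (fun _ => zero_le_one) (by simpa using hg.1)
    (fun t _ => by simpa using integrable_normalPDF 0 t⁻¹)
    (fun t ht => by simpa using integral_normalPDF (inv_pos.mpr ht) 0)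
  simp only [mul_one, hg.2] at this
  exact this

theorem studentPDF_sq (ha : 1 < a) (hr : 0 < r) :
    Integrable (fun x => studentPDF a r x * x ^ 2) ∧
      ∫ x, studentPDF a r x * x ^ 2 = r / (a - 1) := by
  have hg := gammaPDFReal_inv_integral ha hr
  have := studentPDF_mixture (by linarith) hr (h := fun x => x ^ 2) (e := fun t => t⁻¹)
    (by fun_prop) (fun _ => sq_nonneg _) hg.1
    (fun t ht => by simpa using (normalPDF_sq (inv_pos.mpr ht) 0).1)
    (fun t ht => by simpa using (normalPDF_sq (inv_pos.mpr ht) 0).2)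
  rw [hg.2] at this
  exact this

/-- The bound `|x| ≤ 1 + x²` gives integrability, and evenness of the density makes the mean vanish.
-/
theorem studentPDF_mean (ha : 1 < a) (hr : 0 < r) :
    Integrable (fun x => studentPDF a r x * x) ∧ ∫ x, studentPDF a r x * x = 0 := by
  constructor
  · refine ((studentPDF_integral (by linarith : 0 < a) hr).1.add (studentPDF_sq ha hr).1).mono'
      ((measurable_studentPDF a r).mul measurable_id).aestronglyMeasurable
      (Filter.Eventually.of_forall fun x => ?_)
    have h0 := studentPDF_pos (by linarith : 0 < a) hr x
    simp only [Pi.add_apply]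
    rw [norm_mul, Real.norm_of_nonneg h0.le, ← mul_one_add]
    refine mul_le_mul_of_nonneg_left ?_ h0.le
    exact abs_le.mpr ⟨by nlinarith [sq_nonneg (x + 1)], by nlinarith [sq_nonneg (x - 1)]⟩
  · have h := integral_neg_eq_self (fun x => studentPDF a r x * x) volume
    have h' : ∀ x, studentPDF a r (-x) * -x = -(studentPDF a r x * x) := fun x => by
      simp [studentPDF]
    simp only [h', integral_neg] at h
    linarith

/-- The log-density is a constant minus a multiple of `log (r + x²/2)`, hence at most quadratic, and
the second moment dominates. -/
theorem integrable_studentPDF_mul_log (ha : 1 < a) (hr : 0 < r) :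
    Integrable fun x => studentPDF a r x * Real.log (studentPDF a r x) := by
  have ha0 : 0 < a := by linarith
  set A := r ^ a * Real.Gamma (a + 1 / 2) / (√(2 * Real.pi) * Real.Gamma a) with hA
  have hA0 : 0 < A := by
    have h1 := Real.Gamma_pos_of_pos ha0
    have h2 : 0 < Real.Gamma (a + 1 / 2) := Real.Gamma_pos_of_pos (by linarith)
    positivity
  refine (((studentPDF_integral ha0 hr).1.const_mul
    (|Real.log A| + (a + 1 / 2) * (|Real.log r| + r))).add
      ((studentPDF_sq ha hr).1.const_mul ((a + 1 / 2) / 2))).mono'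
    ((measurable_studentPDF a r).mul (Real.measurable_log.comp
      (measurable_studentPDF a r))).aestronglyMeasurable
    (Filter.Eventually.of_forall fun x => ?_)
  have h0 := studentPDF_pos ha0 hr x
  have hR : 0 < r + x ^ 2 / 2 := by positivity
  have hlog : Real.log (studentPDF a r x) = Real.log A - (a + 1 / 2) * Real.log (r + x ^ 2 / 2) := by
    rw [studentPDF, ← hA, Real.log_mul hA0.ne' (by positivity), Real.log_rpow hR]
    ring
  have h1 : |Real.log (r + x ^ 2 / 2)| ≤ |Real.log r| + r + x ^ 2 / 2 := by
    have e1 := Real.log_le_sub_one_of_pos hR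
    have e2 := Real.log_le_log hr (show r ≤ r + x ^ 2 / 2 by linarith [sq_nonneg x])
    have e3 := neg_abs_le (Real.log r)
    exact abs_le.mpr ⟨by linarith, by linarith [abs_nonneg (Real.log r)]⟩
  have h2 : |Real.log (studentPDF a r x)| ≤
      |Real.log A| + (a + 1 / 2) * (|Real.log r| + r + x ^ 2 / 2) := by
    rw [hlog]
    refine (abs_sub _ _).trans (add_le_add le_rfl ?_)
    rw [abs_mul, abs_of_pos (by linarith : 0 < a + 1 / 2)]
    exact mul_le_mul_of_nonneg_left h1 (by linarith)
  simp only [Pi.add_apply]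
  rw [norm_mul, Real.norm_of_nonneg h0.le]
  refine (mul_le_mul_of_nonneg_left h2 h0.le).trans (le_of_eq ?_)
  ring

end Student

/-! ### Normal-gamma conjugacy and the predictive distribution. -/

section NormalGamma

variable {D : ℕ}

/-- Admissible normal-gamma parameters. -/
structure NGParam.Valid (q : NGParam D) : Prop where
  posDef : q.Λ.PosDef
  shape_pos : 0 < q.α
  rate_pos : 0 < q.β

/-- The squared scale factor `φᵀ Λ⁻¹ φ + 1` of the predictive distribution. -/
def NGParam.scaleSq (q : NGParam D) (f : Fin D → ℝ) : ℝ := f ⬝ᵥ (q.Λ⁻¹ *ᵥ f) + 1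

/-- The predictive density at `y` for the regressor `f`. -/
def NGParam.evidence (q : NGParam D) (f : Fin D → ℝ) (y : ℝ) : ℝ :=
  (√(q.scaleSq f))⁻¹ * studentPDF q.α q.β ((y - q.μ ⬝ᵥ f) / √(q.scaleSq f))

variable {q : NGParam D}

theorem NGParam.Valid.scaleSq_pos (hq : q.Valid) (f : Fin D → ℝ) : 0 < q.scaleSq f :=
  one_add_quadForm_inv_pos hq.posDef f

theorem NGParam.Valid.update (hq : q.Valid) (f : Fin D → ℝ) (y : ℝ) : (q.update f y).Valid where
  posDef := posDef_vecMulVec_add hq.posDef f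
  shape_pos := by have := hq.shape_pos; simp only [NGParam.update]; linarith
  rate_pos := by
    rw [update_rate_eq q hq.posDef]
    have := hq.rate_pos
    have := one_add_quadForm_inv_pos hq.posDef f
    positivity

theorem NGParam.Valid.evidence_pos (hq : q.Valid) (f : Fin D → ℝ) (y : ℝ) :
    0 < q.evidence f y :=
  mul_pos (inv_pos.mpr (Real.sqrt_pos.mpr (hq.scaleSq_pos f)))
    (studentPDF_pos hq.shape_pos hq.rate_pos _)

theorem measurable_evidence (q : NGParam D) (f : Fin D → ℝ) : Measurable (q.evidence f) :=
  ((measurable_studentPDF _ _).comp (by fun_prop)).const_mul _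

theorem mvNormalPDF_inv_eq {S : Matrix (Fin D) (Fin D) ℝ} (hS : S.det ≠ 0) (μ θ : Fin D → ℝ) :
    mvNormalPDF μ S⁻¹ θ = (√((2 * Real.pi) ^ D * S.det⁻¹))⁻¹ *
      Real.exp (-(1 / 2) * ((θ - μ) ⬝ᵥ (S *ᵥ (θ - μ)))) := by
  rw [mvNormalPDF, nonsing_inv_nonsing_inv _ hS.isUnit, det_nonsing_inv, Ring.inverse_eq_inv']

theorem mvNormalPDF_integral {S : Matrix (Fin D) (Fin D) ℝ} (hS : S.PosDef) (μ : Fin D → ℝ) :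
    Integrable (mvNormalPDF μ S⁻¹) ∧ ∫ θ, mvNormalPDF μ S⁻¹ θ = 1 := by
  have h := quadForm_gaussian hS μ
  have hfun : mvNormalPDF μ S⁻¹ = fun θ => (√((2 * Real.pi) ^ D * S.det⁻¹))⁻¹ *
      Real.exp (-(1 / 2) * ((θ - μ) ⬝ᵥ (S *ᵥ (θ - μ)))) :=
    funext fun θ => mvNormalPDF_inv_eq hS.det_pos.ne' μ θ
  rw [hfun]
  refine ⟨h.1.const_mul _, ?_⟩
  rw [integral_const_mul, h.2, inv_mul_cancel₀]
  have := hS.det_pos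
  positivity

theorem mvNormalPDF_nonneg (μ : Fin D → ℝ) (S : Matrix (Fin D) (Fin D) ℝ) (θ : Fin D → ℝ) :
    0 ≤ mvNormalPDF μ S θ := by
  unfold mvNormalPDF; positivity

theorem mvNormalPDF_inv_smul_eq {Λ : Matrix (Fin D) (Fin D) ℝ} (hΛ : Λ.PosDef) (μ θ : Fin D → ℝ)
    {τ : ℝ} (hτ : τ ≠ 0) :
    mvNormalPDF μ (τ • Λ)⁻¹ θ = (√((2 * Real.pi) ^ D * (τ ^ D * Λ.det)⁻¹))⁻¹ *
      Real.exp (-(1 / 2) * (τ * ((θ - μ) ⬝ᵥ (Λ *ᵥ (θ - μ))))) := by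
  have hdet : (τ • Λ).det = τ ^ D * Λ.det := by simp
  rw [mvNormalPDF_inv_eq (by rw [hdet]; exact mul_ne_zero (pow_ne_zero _ hτ) hΛ.det_pos.ne'), hdet,
    smul_mulVec, dotProduct_smul, smul_eq_mul]

theorem ae_snd_ne_zero : ∀ᵐ w : (Fin D → ℝ) × ℝ, w.2 ≠ 0 :=
  Measure.quasiMeasurePreserving_snd.ae (Measure.ae_ne volume (0 : ℝ))

theorem ae_snd_snd_ne_zero : ∀ᵐ z : ℝ × (Fin D → ℝ) × ℝ, z.2.2 ≠ 0 :=
  Measure.quasiMeasurePreserving_snd.ae ae_snd_ne_zero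

/-- Almost everywhere the matrix inverse depending on `τ` can be replaced by an explicit formula
whose measurability is evident. -/
theorem NGParam.Valid.aestronglyMeasurable_pdf (hq : q.Valid) :
    AEStronglyMeasurable fun w : (Fin D → ℝ) × ℝ => q.pdf w.1 w.2 := by
  have hc : Continuous fun w : (Fin D → ℝ) × ℝ => (w.1 - q.μ) ⬝ᵥ (q.Λ *ᵥ (w.1 - q.μ)) := by
    fun_prop
  have hm : Measurable fun w : (Fin D → ℝ) × ℝ =>
      (√((2 * Real.pi) ^ D * (w.2 ^ D * q.Λ.det)⁻¹))⁻¹ *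
        Real.exp (-(1 / 2) * (w.2 * ((w.1 - q.μ) ⬝ᵥ (q.Λ *ᵥ (w.1 - q.μ))))) *
          gammaPDFReal q.α q.β w.2 := by
    have := hc.measurable
    have : Measurable fun w : (Fin D → ℝ) × ℝ => gammaPDFReal q.α q.β w.2 :=
      (measurable_gammaPDFReal q.α q.β).comp measurable_snd
    fun_prop
  refine hm.aestronglyMeasurable.congr ?_
  filter_upwards [ae_snd_ne_zero] with w hw
  rw [NGParam.pdf, mvNormalPDF_inv_smul_eq hq.posDef _ _ hw]

theorem NGParam.pdf_of_neg (q : NGParam D) (θ : Fin D → ℝ) {τ : ℝ} (hτ : τ < 0) :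
    q.pdf θ τ = 0 := by
  simp [NGParam.pdf, gammaPDFReal_of_neg hτ]

theorem NGParam.Valid.pdf_pos (hq : q.Valid) (θ : Fin D → ℝ) {τ : ℝ} (hτ : 0 < τ) :
    0 < q.pdf θ τ := by
  rw [NGParam.pdf, mvNormalPDF_inv_smul_eq hq.posDef _ _ hτ.ne']
  have := gammaPDFReal_pos hq.shape_pos hq.rate_pos hτ
  have := hq.posDef.det_pos
  positivity

theorem NGParam.Valid.pdf_nonneg (hq : q.Valid) (θ : Fin D → ℝ) (τ : ℝ) : 0 ≤ q.pdf θ τ :=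
  mul_nonneg (mvNormalPDF_nonneg _ _ _) (gammaPDFReal_nonneg hq.shape_pos hq.rate_pos _)

/-- The second marginal of the normal-gamma distribution is the gamma distribution. -/
theorem NGParam.Valid.integral_pdf_mul (hq : q.Valid) {c : ℝ → ℝ} (hc : Measurable c)
    (hint : Integrable fun τ => gammaPDFReal q.α q.β τ * c τ) :
    Integrable (fun w : (Fin D → ℝ) × ℝ => q.pdf w.1 w.2 * c w.2) ∧
      ∫ w : (Fin D → ℝ) × ℝ, q.pdf w.1 w.2 * c w.2 = ∫ τ, gammaPDFReal q.α q.β τ * c τ := by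
  refine integrable_and_integral_of_sections_symm (μ := volume) (ν := volume)
    (hq.aestronglyMeasurable_pdf.mul (hc.comp measurable_snd).aestronglyMeasurable) hint ?_
  filter_upwards [Measure.ae_ne volume (0 : ℝ)] with τ hτ
  rcases hτ.lt_or_gt with hτ | hτ
  · exact ⟨0, 0, by simp [NGParam.pdf_of_neg q _ hτ], by simp, by simp [Pi.zero_def],
      by simp [gammaPDFReal_of_neg hτ]⟩
  · have h := mvNormalPDF_integral (hq.posDef.smul hτ) q.μ
    refine ⟨gammaPDFReal q.α q.β τ * c τ, mvNormalPDF q.μ (τ • q.Λ)⁻¹,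
      Filter.Eventually.of_forall fun θ => ?_, mvNormalPDF_nonneg _ _, h.1, by rw [h.2, mul_one]⟩
    simp only [NGParam.pdf]
    ring

theorem NGParam.Valid.integral_pdf (hq : q.Valid) :
    Integrable (fun w : (Fin D → ℝ) × ℝ => q.pdf w.1 w.2) ∧
      ∫ w : (Fin D → ℝ) × ℝ, q.pdf w.1 w.2 = 1 := by
  have hg := gammaPDFReal_integral hq.shape_pos hq.rate_pos
  have := hq.integral_pdf_mul (c := fun _ => 1) measurable_const (by simpa using hg.1)
  simp only [mul_one, hg.2] at this
  exact this

/-- Conjugacy of the normal-gamma distribution: Bayes' rule in closed form. -/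
theorem NGParam.Valid.normalPDF_mul_pdf (hq : q.Valid) (f θ : Fin D → ℝ) (y : ℝ) {τ : ℝ}
    (hτ : τ ≠ 0) :
    normalPDF (θ ⬝ᵥ f) τ⁻¹ y * q.pdf θ τ = q.evidence f y * (q.update f y).pdf θ τ := by
  rcases hτ.lt_or_gt with hτ | hτ
  · simp [NGParam.pdf_of_neg _ _ hτ]
  have hs := hq.scaleSq_pos f
  set σ := √(q.scaleSq f) with hσ
  have hσ0 : 0 < σ := Real.sqrt_pos.mpr hs
  have hσ2 : σ ^ 2 = q.scaleSq f := Real.sq_sqrt hs.le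
  set x := (y - q.μ ⬝ᵥ f) / σ with hx
  have hx2 : x ^ 2 = (y - q.μ ⬝ᵥ f) ^ 2 / q.scaleSq f := by rw [hx, div_pow, hσ2]
  have hβ : (q.update f y).β = q.β + x ^ 2 / 2 := by
    rw [update_rate_eq q hq.posDef, hx2]; rfl
  have hα : (q.update f y).α = q.α + 1 / 2 := rfl
  have hgam := normalPDF_mul_gammaPDFReal hq.shape_pos hq.rate_pos x hτ.ne'
  have hsq := sq_add_quadForm_eq hq.posDef q.μ f θ y
  -- Gaussian half of conjugacy: the exponents match by completing the square, and the determinant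
  -- ratio `σ²` yields the factor `σ⁻¹`. The remaining scalar normal-gamma product is handled by
  -- `hgam`.
  have hgauss : normalPDF (θ ⬝ᵥ f) τ⁻¹ y * mvNormalPDF q.μ (τ • q.Λ)⁻¹ θ =
      σ⁻¹ * normalPDF 0 τ⁻¹ x *
        mvNormalPDF (q.update f y).μ (τ • (q.update f y).Λ)⁻¹ θ := by
    rw [normalPDF_eq (inv_pos.mpr hτ), normalPDF_eq (inv_pos.mpr hτ),
      mvNormalPDF_inv_smul_eq hq.posDef _ _ hτ.ne',
      mvNormalPDF_inv_smul_eq (hq.update f y).posDef _ _ hτ.ne']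
    have hdet : (q.update f y).Λ.det = q.Λ.det * σ ^ 2 := by
      rw [hσ2]; exact det_vecMulVec_add hq.posDef f
    have hΛ0 := hq.posDef.det_pos
    have hpre : (√((2 * Real.pi) ^ D * (τ ^ D * (q.update f y).Λ.det)⁻¹))⁻¹ =
        σ * (√((2 * Real.pi) ^ D * (τ ^ D * q.Λ.det)⁻¹))⁻¹ := by
      have e : (2 * Real.pi) ^ D * (τ ^ D * (q.update f y).Λ.det)⁻¹ =
          ((2 * Real.pi) ^ D * (τ ^ D * q.Λ.det)⁻¹) * (σ⁻¹) ^ 2 := by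
        rw [hdet]; field_simp
      rw [e, Real.sqrt_mul (by positivity), Real.sqrt_sq (by positivity), mul_inv, inv_inv,
        mul_comm]
    have hexp : Real.exp (-(y - θ ⬝ᵥ f) ^ 2 / (2 * τ⁻¹)) *
        Real.exp (-(1 / 2) * (τ * ((θ - q.μ) ⬝ᵥ (q.Λ *ᵥ (θ - q.μ))))) =
        Real.exp (-(x - 0) ^ 2 / (2 * τ⁻¹)) *
        Real.exp (-(1 / 2) * (τ * ((θ - (q.update f y).μ) ⬝ᵥ
          ((q.update f y).Λ *ᵥ (θ - (q.update f y).μ))))) := by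
      rw [← Real.exp_add, ← Real.exp_add]
      congr 1
      have e : ∀ b : ℝ, -b / (2 * τ⁻¹) = -(τ / 2) * b := fun b => by field_simp
      rw [sub_zero, e, e, hx2]
      simp only [NGParam.update, NGParam.scaleSq] at hsq ⊢
      linear_combination (-(τ / 2)) * hsq
    rw [hpre]
    have e2 := inv_mul_cancel₀ hσ0.ne'
    linear_combination ((√(2 * Real.pi * τ⁻¹))⁻¹ *
      (√((2 * Real.pi) ^ D * (τ ^ D * q.Λ.det)⁻¹))⁻¹) * hexp -
      ((√(2 * Real.pi * τ⁻¹))⁻¹ * (√((2 * Real.pi) ^ D * (τ ^ D * q.Λ.det)⁻¹))⁻¹ *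
        Real.exp (-(x - 0) ^ 2 / (2 * τ⁻¹)) *
        Real.exp (-(1 / 2) * (τ * ((θ - (q.update f y).μ) ⬝ᵥ
          ((q.update f y).Λ *ᵥ (θ - (q.update f y).μ)))))) * e2
  rw [NGParam.pdf, NGParam.pdf, NGParam.evidence, ← hσ, ← hx, hβ, hα]
  linear_combination gammaPDFReal q.α q.β τ * hgauss +
    σ⁻¹ * mvNormalPDF (q.update f y).μ (τ • (q.update f y).Λ)⁻¹ θ * hgam

theorem NGParam.Valid.integral_normalPDF_mul_pdf (hq : q.Valid) (f : Fin D → ℝ) (y : ℝ) :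
    ∫ w : (Fin D → ℝ) × ℝ, normalPDF (w.1 ⬝ᵥ f) w.2⁻¹ y * q.pdf w.1 w.2 = q.evidence f y := by
  rw [← mul_one (q.evidence f y), ← (hq.update f y).integral_pdf.2, ← integral_const_mul]
  refine integral_congr_ae ?_
  filter_upwards [ae_snd_ne_zero] with w hw using hq.normalPDF_mul_pdf f w.1 y hw

/-- Expectations under the predictive distribution, by standardization. -/
theorem NGParam.Valid.integral_evidence_mul (hq : q.Valid) (f : Fin D → ℝ) {h : ℝ → ℝ}
    (hint : Integrable fun x =>
      studentPDF q.α q.β x * h (√(q.scaleSq f) * x + q.μ ⬝ᵥ f)) :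
    Integrable (fun y => q.evidence f y * h y) ∧
      ∫ y, q.evidence f y * h y =
        ∫ x, studentPDF q.α q.β x * h (√(q.scaleSq f) * x + q.μ ⬝ᵥ f) := by
  have hσ0 : 0 < √(q.scaleSq f) := Real.sqrt_pos.mpr (hq.scaleSq_pos f)
  have hfun : (fun y => q.evidence f y * h y) = fun y => (√(q.scaleSq f))⁻¹ *
      (fun x => studentPDF q.α q.β (x / √(q.scaleSq f)) *
        h (√(q.scaleSq f) * (x / √(q.scaleSq f)) + q.μ ⬝ᵥ f)) (y - q.μ ⬝ᵥ f) := by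
    ext y
    simp only [NGParam.evidence]
    rw [mul_div_cancel₀ _ hσ0.ne', sub_add_cancel, mul_assoc]
  rw [hfun]
  constructor
  · exact ((hint.comp_div hσ0.ne').comp_sub_right _).const_mul _
  · rw [integral_const_mul, integral_sub_right_eq_self (fun x =>
      studentPDF q.α q.β (x / √(q.scaleSq f)) *
        h (√(q.scaleSq f) * (x / √(q.scaleSq f)) + q.μ ⬝ᵥ f)),
      Measure.integral_comp_div (fun x => studentPDF q.α q.β x *
        h (√(q.scaleSq f) * x + q.μ ⬝ᵥ f)), abs_of_pos hσ0, smul_eq_mul, ← mul_assoc,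
      inv_mul_cancel₀ hσ0.ne', one_mul]

theorem NGParam.Valid.evidence_integral (hq : q.Valid) (f : Fin D → ℝ) :
    Integrable (q.evidence f) ∧ ∫ y, q.evidence f y = 1 := by
  have hg := studentPDF_integral hq.shape_pos hq.rate_pos
  have := hq.integral_evidence_mul f (h := fun _ => 1) (by simpa using hg.1)
  simp only [mul_one, hg.2] at this
  exact this

/-- Expand the square after standardizing; the cross term vanishes with the Student mean. -/
theorem NGParam.Valid.evidence_sq (hq : q.Valid) (hα : 1 < q.α) (f : Fin D → ℝ) (m : ℝ) :
    Integrable (fun y => q.evidence f y * (y - m) ^ 2) ∧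
      ∫ y, q.evidence f y * (y - m) ^ 2 =
        (q.μ ⬝ᵥ f - m) ^ 2 + q.scaleSq f * (q.β / (q.α - 1)) := by
  have h0 := studentPDF_integral hq.shape_pos hq.rate_pos
  have h1 := studentPDF_mean hα hq.rate_pos
  have h2 := studentPDF_sq hα hq.rate_pos
  have hfun : (fun x => studentPDF q.α q.β x *
      (fun y => (y - m) ^ 2) (√(q.scaleSq f) * x + q.μ ⬝ᵥ f)) = fun x =>
      q.scaleSq f * (studentPDF q.α q.β x * x ^ 2) +
        2 * √(q.scaleSq f) * (q.μ ⬝ᵥ f - m) * (studentPDF q.α q.β x * x) +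
        (q.μ ⬝ᵥ f - m) ^ 2 * studentPDF q.α q.β x := by
    ext x
    have := Real.sq_sqrt (hq.scaleSq_pos f).le
    linear_combination (studentPDF q.α q.β x * x ^ 2) * this
  have i2 := h2.1.const_mul (q.scaleSq f)
  have i1 := h1.1.const_mul (2 * √(q.scaleSq f) * (q.μ ⬝ᵥ f - m))
  have i21 : Integrable fun x => q.scaleSq f * (studentPDF q.α q.β x * x ^ 2) +
      2 * √(q.scaleSq f) * (q.μ ⬝ᵥ f - m) * (studentPDF q.α q.β x * x) := i2.add i1
  have i0 := h0.1.const_mul ((q.μ ⬝ᵥ f - m) ^ 2)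
  have := hq.integral_evidence_mul f (h := fun y => (y - m) ^ 2) (by
    rw [hfun]; exact i21.add i0)
  refine ⟨this.1, this.2.trans ?_⟩
  rw [hfun, integral_add i21 i0, integral_add i2 i1, integral_const_mul, integral_const_mul,
    integral_const_mul, h0.2, h1.2, h2.2]
  ring

/-- In a location-scale family the entropy changes only by the logarithm of the scale, so the
Student integral is free of `f`. -/
theorem NGParam.Valid.evidence_log (hq : q.Valid) (hα : 1 < q.α) (f : Fin D → ℝ) :
    Integrable (fun y => q.evidence f y * Real.log (q.evidence f y)) ∧
      ∫ y, q.evidence f y * Real.log (q.evidence f y) =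
        -(1 / 2) * Real.log (q.scaleSq f) +
          ∫ x, studentPDF q.α q.β x * Real.log (studentPDF q.α q.β x) := by
  have h0 := studentPDF_integral hq.shape_pos hq.rate_pos
  have h1 := integrable_studentPDF_mul_log hα hq.rate_pos
  have hσ0 : 0 < √(q.scaleSq f) := Real.sqrt_pos.mpr (hq.scaleSq_pos f)
  have hfun : (fun x => studentPDF q.α q.β x *
      (fun y => Real.log (q.evidence f y)) (√(q.scaleSq f) * x + q.μ ⬝ᵥ f)) = fun x =>
      -(1 / 2) * Real.log (q.scaleSq f) * studentPDF q.α q.β x +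
        studentPDF q.α q.β x * Real.log (studentPDF q.α q.β x) := by
    ext x
    simp only [NGParam.evidence]
    rw [add_sub_cancel_right, mul_div_cancel_left₀ _ hσ0.ne',
      Real.log_mul (inv_pos.mpr hσ0).ne' (studentPDF_pos hq.shape_pos hq.rate_pos x).ne',
      Real.log_inv, Real.log_sqrt (hq.scaleSq_pos f).le]
    ring
  have i0 := h0.1.const_mul (-(1 / 2) * Real.log (q.scaleSq f))
  have := hq.integral_evidence_mul f (h := fun y => Real.log (q.evidence f y)) (by
    rw [hfun]; exact i0.add h1)
  refine ⟨this.1, this.2.trans ?_⟩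
  rw [hfun, integral_add i0 h1, integral_const_mul, h0.2, mul_one]

end NormalGamma

/-! ### Filtering in closed form, mutual information, cross-entropy and expected free energy. -/

namespace Agent

variable {My Mu D : ℕ} {A : Agent My Mu D}

theorem valid_param (h : A.prior.Valid) : ∀ k, (A.param k).Valid
  | 0 => h
  | k + 1 => (valid_param h k).update _ _

/-- By induction, each normalizing integral is the evidence and cancels the factor from conjugacy.
At `τ = 0` the likelihood has default value 0, which the closed form need not share. -/
theorem posterior_eq (h : A.prior.Valid) (k : ℕ) (θ : Fin D → ℝ) {τ : ℝ} (hτ : τ ≠ 0) :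
    A.posterior k θ τ = (A.param k).pdf θ τ := by
  induction k generalizing θ τ with
  | zero => rfl
  | succ k ih =>
    have hq := valid_param h k
    have hint : ∫ w : (Fin D → ℝ) × ℝ,
        A.likelihood (k + 1) (A.uObs (k + 1)) (A.yObs (k + 1)) w.1 w.2 * A.posterior k w.1 w.2 =
        (A.param k).evidence (A.feature (k + 1) (A.uObs (k + 1))) (A.yObs (k + 1)) := by
      rw [← hq.integral_normalPDF_mul_pdf]
      refine integral_congr_ae ?_
      filter_upwards [ae_snd_ne_zero] with w hw
      rw [ih w.1 hw, likelihood]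
    simp only [posterior]
    rw [hint, ih θ hτ, likelihood, hq.normalPDF_mul_pdf _ _ _ hτ,
      mul_div_cancel_left₀ _ (hq.evidence_pos _ _).ne']
    rfl

theorem joint_eq (h : A.prior.Valid) (k : ℕ) (u y : ℝ) (θ : Fin D → ℝ) {τ : ℝ} (hτ : τ ≠ 0) :
    A.joint k u y θ τ = (A.param k).evidence (A.feature (k + 1) u) y *
      ((A.param k).update (A.feature (k + 1) u) y).pdf θ τ := by
  rw [joint, posterior_eq h k θ hτ, likelihood, (valid_param h k).normalPDF_mul_pdf _ _ _ hτ]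

theorem predictive_eq (h : A.prior.Valid) (k : ℕ) (u y : ℝ) :
    A.predictive k u y = (A.param k).evidence (A.feature (k + 1) u) y := by
  rw [predictive, ← (valid_param h k).integral_normalPDF_mul_pdf]
  refine integral_congr_ae ?_
  filter_upwards [ae_snd_ne_zero] with w hw
  rw [joint, posterior_eq h k w.1 hw, likelihood]

theorem measurable_likelihood (A : Agent My Mu D) (k : ℕ) (u : ℝ) :
    Measurable fun z : ℝ × (Fin D → ℝ) × ℝ => A.likelihood (k + 1) u z.1 z.2.1 z.2.2 := by
  have hc : Continuous fun z : ℝ × (Fin D → ℝ) × ℝ => z.2.1 ⬝ᵥ A.feature (k + 1) u := by fun_prop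
  exact measurable_normalPDF_comp hc.measurable measurable_snd.snd.inv measurable_fst

theorem aestronglyMeasurable_joint (h : A.prior.Valid) (k : ℕ) (u : ℝ) :
    AEStronglyMeasurable fun z : ℝ × (Fin D → ℝ) × ℝ => A.joint k u z.1 z.2.1 z.2.2 := by
  have hpost : AEStronglyMeasurable fun z : ℝ × (Fin D → ℝ) × ℝ =>
      (A.param k).pdf z.2.1 z.2.2 :=
    (valid_param h k).aestronglyMeasurable_pdf.comp_snd
  refine ((measurable_likelihood A k u).aestronglyMeasurable.mul hpost).congr ?_
  filter_upwards [ae_snd_snd_ne_zero] with z hz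
  rw [joint, posterior_eq h k _ hz]
  rfl

/-- Expectations of functions of the output reduce to the predictive distribution. -/
theorem integral_joint_mul_output (h : A.prior.Valid) (k : ℕ) (u : ℝ) {b : ℝ → ℝ}
    (hb : Measurable b)
    (hint : Integrable fun y => (A.param k).evidence (A.feature (k + 1) u) y * b y) :
    Integrable (fun z : ℝ × (Fin D → ℝ) × ℝ => A.joint k u z.1 z.2.1 z.2.2 * b z.1) ∧
      ∫ z : ℝ × (Fin D → ℝ) × ℝ, A.joint k u z.1 z.2.1 z.2.2 * b z.1 =
        ∫ y, (A.param k).evidence (A.feature (k + 1) u) y * b y := by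
  refine integrable_and_integral_of_sections (μ := volume) (ν := volume)
    ((aestronglyMeasurable_joint h k u).mul (hb.comp measurable_fst).aestronglyMeasurable) hint ?_
  refine Filter.Eventually.of_forall fun y => ?_
  have hq := (valid_param h k).update (A.feature (k + 1) u) y
  refine ⟨(A.param k).evidence (A.feature (k + 1) u) y * b y, _, ?_,
    fun w => hq.pdf_nonneg w.1 w.2, hq.integral_pdf.1, by rw [hq.integral_pdf.2, mul_one]⟩
  filter_upwards [ae_snd_ne_zero] with w hw
  rw [joint_eq h k u y w.1 hw]
  ring

/-- Expectations of functions whose conditional expectation given the parameters depends only on the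
precision. -/
theorem integral_joint_mul_param (h : A.prior.Valid) (k : ℕ) (u : ℝ) {c : ℝ → ℝ}
    {ρ : ℝ × (Fin D → ℝ) × ℝ → ℝ} (hc : Measurable c) (hρ : Measurable ρ)
    (hint : Integrable fun τ => gammaPDFReal (A.param k).α (A.param k).β τ * c τ)
    (hρ0 : ∀ y θ τ, 0 < τ → 0 ≤ ρ (y, θ, τ))
    (hρint : ∀ θ τ, 0 < τ → Integrable fun y => A.likelihood (k + 1) u y θ τ * ρ (y, θ, τ))
    (hρval : ∀ θ τ, 0 < τ → ∫ y, A.likelihood (k + 1) u y θ τ * ρ (y, θ, τ) = 1) :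
    Integrable (fun z : ℝ × (Fin D → ℝ) × ℝ =>
        A.joint k u z.1 z.2.1 z.2.2 * (c z.2.2 * ρ z)) ∧
      ∫ z : ℝ × (Fin D → ℝ) × ℝ, A.joint k u z.1 z.2.1 z.2.2 * (c z.2.2 * ρ z) =
        ∫ τ, gammaPDFReal (A.param k).α (A.param k).β τ * c τ := by
  obtain ⟨h1, h2⟩ := (valid_param h k).integral_pdf_mul hc hint
  rw [← h2]
  refine integrable_and_integral_of_sections_symm (μ := volume) (ν := volume)
    ((aestronglyMeasurable_joint h k u).mul
      ((hc.comp measurable_snd.snd).mul hρ).aestronglyMeasurable) h1 ?_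
  filter_upwards [ae_snd_ne_zero] with w hw
  rcases hw.lt_or_gt with hτ | hτ
  · refine ⟨0, 0, Filter.Eventually.of_forall fun y => ?_, by simp, by simp [Pi.zero_def],
      by simp [NGParam.pdf_of_neg _ _ hτ]⟩
    simp [joint, posterior_eq h k w.1 hw, NGParam.pdf_of_neg _ _ hτ]
  · refine ⟨(A.param k).pdf w.1 w.2 * c w.2,
      fun y => A.likelihood (k + 1) u y w.1 w.2 * ρ (y, w.1, w.2), Filter.Eventually.of_forall fun y => ?_,
      fun y => mul_nonneg (normalPDF_nonneg _ _ _) (hρ0 y w.1 w.2 hτ), hρint w.1 w.2 hτ,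
      by rw [hρval w.1 w.2 hτ, mul_one]⟩
    rw [joint, posterior_eq h k w.1 hw]
    ring

/-- The expected log-likelihood does not depend on the control. -/
theorem integral_joint_mul_log_likelihood (h : A.prior.Valid) (k : ℕ) (hα : 1 < (A.param k).α)
    (u : ℝ) :
    Integrable (fun z : ℝ × (Fin D → ℝ) × ℝ => A.joint k u z.1 z.2.1 z.2.2 *
        Real.log (A.likelihood (k + 1) u z.1 z.2.1 z.2.2)) ∧
      ∫ z : ℝ × (Fin D → ℝ) × ℝ, A.joint k u z.1 z.2.1 z.2.2 *
        Real.log (A.likelihood (k + 1) u z.1 z.2.1 z.2.2) =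
      -(1 / 2) * Real.log (2 * Real.pi) +
        1 / 2 * (∫ τ, gammaPDFReal (A.param k).α (A.param k).β τ * Real.log τ) - 1 / 2 := by
  have hq := valid_param h k
  have hg := gammaPDFReal_integral hq.shape_pos hq.rate_pos
  have hlog := integrable_gammaPDFReal_mul_log hα hq.rate_pos
  have hone : Integrable fun τ => gammaPDFReal (A.param k).α (A.param k).β τ * 1 := by
    simpa using hg.1
  have hlik : ∀ θ τ, Integrable fun y => A.likelihood (k + 1) u y θ τ * 1 := fun θ τ => by
    simpa [likelihood] using integrable_normalPDF (θ ⬝ᵥ A.feature (k + 1) u) τ⁻¹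
  have hlik' : ∀ θ τ, 0 < τ → ∫ y, A.likelihood (k + 1) u y θ τ * 1 = 1 := fun θ τ hτ => by
    simpa [likelihood] using integral_normalPDF (inv_pos.mpr hτ) (θ ⬝ᵥ A.feature (k + 1) u)
  have hcont : Continuous fun z : ℝ × (Fin D → ℝ) × ℝ =>
      z.2.2 * (z.1 - z.2.1 ⬝ᵥ A.feature (k + 1) u) ^ 2 := by fun_prop
  obtain ⟨i0, e0⟩ := integral_joint_mul_param h k u (c := fun _ => 1) (ρ := fun _ => 1)
    measurable_const measurable_const hone (fun _ _ _ _ => zero_le_one)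
    (fun θ τ _ => hlik θ τ) hlik'
  obtain ⟨i1, e1⟩ := integral_joint_mul_param h k u (c := Real.log) (ρ := fun _ => 1)
    Real.measurable_log measurable_const hlog (fun _ _ _ _ => zero_le_one)
    (fun θ τ _ => hlik θ τ) hlik'
  have hfac : ∀ θ τ, (fun y => A.likelihood (k + 1) u y θ τ *
      (τ * (y - θ ⬝ᵥ A.feature (k + 1) u) ^ 2)) = fun y => τ *
      (normalPDF (θ ⬝ᵥ A.feature (k + 1) u) τ⁻¹ y * (y - θ ⬝ᵥ A.feature (k + 1) u) ^ 2) :=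
    fun θ τ => by ext y; simp only [likelihood]; ring
  -- Scaled by the precision, the squared error has conditional mean one for every `θ` and `τ > 0`;
  -- this is why the control drops out.
  obtain ⟨i2, e2⟩ := integral_joint_mul_param h k u (c := fun _ => 1)
    (ρ := fun z => z.2.2 * (z.1 - z.2.1 ⬝ᵥ A.feature (k + 1) u) ^ 2)
    measurable_const hcont.measurable hone (fun _ _ _ hτ => by positivity)
    (fun θ τ hτ => by
      simp only [hfac]
      exact (normalPDF_sq (inv_pos.mpr hτ) _).1.const_mul τ)
    (fun θ τ hτ => by
      simp only [hfac]
      rw [integral_const_mul, (normalPDF_sq (inv_pos.mpr hτ) _).2, mul_inv_cancel₀ hτ.ne'])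
  simp only [mul_one, hg.2] at e0 e2
  have j0 := i0.const_mul (-(1 / 2) * Real.log (2 * Real.pi))
  have j1 := i1.const_mul (1 / 2)
  have j2 := i2.const_mul (1 / 2)
  have j01 : Integrable fun z : ℝ × (Fin D → ℝ) × ℝ => -(1 / 2) * Real.log (2 * Real.pi) *
      (A.joint k u z.1 z.2.1 z.2.2 * (1 * 1)) +
      1 / 2 * (A.joint k u z.1 z.2.1 z.2.2 * (Real.log z.2.2 * 1)) := j0.add j1
  have hae : (fun z : ℝ × (Fin D → ℝ) × ℝ => -(1 / 2) * Real.log (2 * Real.pi) *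
      (A.joint k u z.1 z.2.1 z.2.2 * (1 * 1)) +
      1 / 2 * (A.joint k u z.1 z.2.1 z.2.2 * (Real.log z.2.2 * 1)) -
      1 / 2 * (A.joint k u z.1 z.2.1 z.2.2 *
        (1 * (z.2.2 * (z.1 - z.2.1 ⬝ᵥ A.feature (k + 1) u) ^ 2)))) =ᵐ[volume]
      fun z => A.joint k u z.1 z.2.1 z.2.2 *
        Real.log (A.likelihood (k + 1) u z.1 z.2.1 z.2.2) := by
    filter_upwards [ae_snd_snd_ne_zero] with z hz
    rcases hz.lt_or_gt with hτ | hτ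
    -- For negative `τ` the variance is truncated to 0, so the likelihood, and with it every
    -- integrand, vanishes.
    · simp [joint, likelihood, normalPDF_of_nonpos (inv_nonpos.mpr hτ.le)]
    · rw [likelihood, log_normalPDF (inv_pos.mpr hτ),
        Real.log_mul (x := 2 * Real.pi) (by positivity) (by positivity), Real.log_inv]
      field_simp
      ring
  refine ⟨(j01.sub j2).congr hae, ?_⟩
  rw [← integral_congr_ae hae, integral_sub j01 j2, integral_add j0 j1, integral_const_mul,
    integral_const_mul, integral_const_mul]
  simp only [mul_one, one_mul] at e0 e1 e2 ⊢
  rw [e0, e1, e2]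
  ring

/-- Cancelling the posterior leaves likelihood over evidence, and the logarithm splits into two
integrable terms. -/
theorem integral_mutualInfo (h : A.prior.Valid) (k : ℕ) (hα : 1 < (A.param k).α) (u : ℝ) :
    Integrable (A.mutualInfoIntegrand k u) ∧
      A.mutualInfo k u =
        (-(1 / 2) * Real.log (2 * Real.pi) +
          1 / 2 * (∫ τ, gammaPDFReal (A.param k).α (A.param k).β τ * Real.log τ) - 1 / 2) -
        (-(1 / 2) * Real.log ((A.param k).scaleSq (A.feature (k + 1) u)) +
          ∫ x, studentPDF (A.param k).α (A.param k).β x *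
            Real.log (studentPDF (A.param k).α (A.param k).β x)) := by
  have hq := valid_param h k
  obtain ⟨i1, e1⟩ := integral_joint_mul_log_likelihood h k hα u
  obtain ⟨i2, e2⟩ := hq.evidence_log hα (A.feature (k + 1) u)
  obtain ⟨i3, e3⟩ := integral_joint_mul_output h k u
    (Real.measurable_log.comp (measurable_evidence _ _)) i2
  have hae : (fun z : ℝ × (Fin D → ℝ) × ℝ => A.joint k u z.1 z.2.1 z.2.2 *
        Real.log (A.likelihood (k + 1) u z.1 z.2.1 z.2.2) - A.joint k u z.1 z.2.1 z.2.2 *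
        (Real.log ∘ (A.param k).evidence (A.feature (k + 1) u)) z.1) =ᵐ[volume]
      A.mutualInfoIntegrand k u := by
    filter_upwards [ae_snd_snd_ne_zero] with z hz
    rw [mutualInfoIntegrand, predictive_eq h]
    rcases hz.lt_or_gt with hτ | hτ
    · simp [joint, likelihood, normalPDF_of_nonpos (inv_nonpos.mpr hτ.le)]
    · have hp : 0 < A.posterior k z.2.1 z.2.2 := by
        rw [posterior_eq h k _ hz]; exact hq.pdf_pos _ hτ
      have hl : 0 < A.likelihood (k + 1) u z.1 z.2.1 z.2.2 := normalPDF_pos (inv_pos.mpr hτ) _ _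
      have he := hq.evidence_pos (A.feature (k + 1) u) z.1
      have : A.joint k u z.1 z.2.1 z.2.2 / (A.posterior k z.2.1 z.2.2 *
          (A.param k).evidence (A.feature (k + 1) u) z.1) =
          A.likelihood (k + 1) u z.1 z.2.1 z.2.2 /
            (A.param k).evidence (A.feature (k + 1) u) z.1 := by
        rw [joint]; field_simp
      rw [this, Real.log_div hl.ne' he.ne', mul_sub]
      rfl
  refine ⟨(i1.sub i3).congr hae, ?_⟩
  rw [mutualInfo, ← integral_congr_ae hae, integral_sub i1 i3, e1, e3, ← e2]
  rfl

theorem integral_crossEntropy (h : A.prior.Valid) (k : ℕ) (hα : 1 < (A.param k).α) (m : ℝ) {v : ℝ}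
    (hv : 0 < v) (u : ℝ) :
    Integrable (A.crossEntropyIntegrand k m v u) ∧
      A.crossEntropy k m v u = 1 / 2 * Real.log (2 * Real.pi * v) +
        1 / (2 * v) * (((A.param k).μ ⬝ᵥ A.feature (k + 1) u - m) ^ 2 +
          (A.param k).scaleSq (A.feature (k + 1) u) * ((A.param k).β / ((A.param k).α - 1))) := by
  have hq := valid_param h k
  obtain ⟨i0, e0⟩ := hq.evidence_integral (A.feature (k + 1) u)
  obtain ⟨i2, e2⟩ := hq.evidence_sq hα (A.feature (k + 1) u) m
  have hfun : A.crossEntropyIntegrand k m v u = fun y =>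
      1 / 2 * Real.log (2 * Real.pi * v) * (A.param k).evidence (A.feature (k + 1) u) y +
        1 / (2 * v) * ((A.param k).evidence (A.feature (k + 1) u) y * (y - m) ^ 2) := by
    ext y
    rw [crossEntropyIntegrand, predictive_eq h, log_normalPDF hv]
    ring
  have j0 := i0.const_mul (1 / 2 * Real.log (2 * Real.pi * v))
  have j2 := i2.const_mul (1 / (2 * v))
  rw [crossEntropy, hfun]
  exact ⟨j0.add j2, by
    rw [integral_add j0 j2, integral_const_mul, integral_const_mul, e0, e2, mul_one]⟩

theorem integral_efe (h : A.prior.Valid) (k : ℕ) (hα : 1 < (A.param k).α) (m : ℝ) {v : ℝ}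
    (hv : 0 < v) (u : ℝ) :
    Integrable (A.efeIntegrand k m v u) ∧
      A.efe k m v u = A.crossEntropy k m v u - A.mutualInfo k u := by
  have hq := valid_param h k
  have iCE := (integral_crossEntropy h k hα m hv u).1
  have iMI := (integral_mutualInfo h k hα u).1
  have hCE : A.crossEntropyIntegrand k m v u = fun y =>
      (A.param k).evidence (A.feature (k + 1) u) y * -Real.log (normalPDF m v y) := by
    ext y
    rw [crossEntropyIntegrand, predictive_eq h]
  obtain ⟨i1, e1⟩ := integral_joint_mul_output h k u (b := fun y => -Real.log (normalPDF m v y))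
    (Real.measurable_log.comp
      (measurable_normalPDF_comp measurable_const measurable_const measurable_id)).neg (hCE ▸ iCE)
  have hae : (fun z : ℝ × (Fin D → ℝ) × ℝ => A.joint k u z.1 z.2.1 z.2.2 *
      -Real.log (normalPDF m v z.1) - A.mutualInfoIntegrand k u z) =ᵐ[volume]
      A.efeIntegrand k m v u := by
    filter_upwards [ae_snd_snd_ne_zero] with z hz
    rw [mutualInfoIntegrand, efeIntegrand, futurePosterior, predictive_eq h]
    rcases hz.lt_or_gt with hτ | hτ
    · simp [joint, likelihood, normalPDF_of_nonpos (inv_nonpos.mpr hτ.le)]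
    · have hp : 0 < A.posterior k z.2.1 z.2.2 := by
        rw [posterior_eq h k _ hz]; exact hq.pdf_pos _ hτ
      have hj : 0 < A.joint k u z.1 z.2.1 z.2.2 :=
        mul_pos (normalPDF_pos (inv_pos.mpr hτ) _ _) hp
      have he := hq.evidence_pos (A.feature (k + 1) u) z.1
      have hn := normalPDF_pos hv m z.1
      rw [Real.log_div hj.ne' (by positivity), Real.log_div hp.ne' (by positivity),
        Real.log_mul hp.ne' he.ne', Real.log_mul (by positivity) hn.ne',
        Real.log_div hj.ne' he.ne']
      ring
  refine ⟨(i1.sub iMI).congr hae, ?_⟩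
  rw [efe, ← integral_congr_ae hae, integral_sub i1 iMI, e1, crossEntropy, hCE]
  rfl

end Agent

end NARX

end

theorem mainTheorem3 {My Mu D : ℕ} (A : NARX.Agent My Mu D)
    (hΛ : A.prior.Λ.PosDef) (hα : 0 < A.prior.α) (hβ : 0 < A.prior.β)
    (m v : ℝ) (hv : 0 < v) (k : ℕ) (hk : 1 < (A.param k).α) :
    ∃ C : ℝ, ∀ u : ℝ,
      Integrable (A.efeIntegrand k m v u) ∧
      Integrable (A.crossEntropyIntegrand k m v u) ∧
      Integrable (A.mutualInfoIntegrand k u) ∧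
      A.efe k m v u = A.crossEntropy k m v u - A.mutualInfo k u ∧
      A.efe k m v u =
        1 / (2 * v) *
            (((A.param k).μ ⬝ᵥ A.feature (k + 1) u - m) ^ 2 +
              (A.param k).β / (A.param k).α *
                (A.feature (k + 1) u ⬝ᵥ ((A.param k).Λ⁻¹ *ᵥ A.feature (k + 1) u) + 1) *
                (2 * (A.param k).α / (2 * (A.param k).α - 2))) -
          1 / 2 * Real.log
            (A.feature (k + 1) u ⬝ᵥ ((A.param k).Λ⁻¹ *ᵥ A.feature (k + 1) u) + 1) +
          C := by
  have h : A.prior.Valid := ⟨hΛ, hα, hβ⟩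
  -- The constant collects the goal's log-normalizer, minus the mean log-likelihood, minus the
  -- differential entropy of the standardized Student law.
  refine ⟨1 / 2 * Real.log (2 * Real.pi * v) -
    (-(1 / 2) * Real.log (2 * Real.pi) +
      1 / 2 * (∫ τ, gammaPDFReal (A.param k).α (A.param k).β τ * Real.log τ) - 1 / 2) +
    ∫ x, NARX.studentPDF (A.param k).α (A.param k).β x *
      Real.log (NARX.studentPDF (A.param k).α (A.param k).β x), fun u => ?_⟩
  obtain ⟨iE, eE⟩ := NARX.Agent.integral_efe h k hk m hv u
  obtain ⟨iC, eC⟩ := NARX.Agent.integral_crossEntropy h k hk m hv u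
  obtain ⟨iM, eM⟩ := NARX.Agent.integral_mutualInfo h k hk u
  refine ⟨iE, iC, iM, eE, ?_⟩
  -- With `ν = 2α` degrees of freedom, the factor `ν / (ν - 2)` turns `β / α` into `β / (α - 1)`.
  have hvar : (A.param k).β / (A.param k).α *
      (A.feature (k + 1) u ⬝ᵥ ((A.param k).Λ⁻¹ *ᵥ A.feature (k + 1) u) + 1) *
      (2 * (A.param k).α / (2 * (A.param k).α - 2)) =
      (A.param k).scaleSq (A.feature (k + 1) u) * ((A.param k).β / ((A.param k).α - 1)) := by
    have h1 : (A.param k).α - 1 ≠ 0 := by linarith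
    have h0 : (A.param k).α ≠ 0 := by linarith
    rw [NARX.NGParam.scaleSq, show 2 * (A.param k).α - 2 = 2 * ((A.param k).α - 1) by ring]
    field_simp
  rw [hvar, eE, eC, eM]
  simp only [NARX.NGParam.scaleSq]
  ring
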